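/- Let $p>1$ and let $q$ be defined by $\frac1p+\frac1q=1$. Let $l^p$ be the Banach space of all complex sequences $\mathbf{x}=(x_n)_{n\ge1}$ with $\|\mathbf{x}\|_p=\left(\sum_{n\ge1}|x_n|^p\right)^{1/p}<\infty$. For real $\alpha,\beta$ let $$H(\alpha,\beta)=\left(\frac{i^{\alpha}j^{\beta}}{(i+j)^{\alpha+\beta+1}}\right)_{i\ge1,\,j\ge1}.$$ If $-\frac1p<\alpha\le2$ and $-\frac1q<\beta\le2$, then $H(\alpha,\beta)$ acts on $l^p$ (for every $\mathbf{x}\in l^p$ the series $\sum_{j\ge1}\frac{i^{\alpha}j^{\beta}}{(i+j)^{\alpha+\beta+1}}x_j$ converge for all $i\ge1$ and define a sequence $H(\alpha,\beta)\mathbf{x}\in l^p$), and $$\|H(\alpha,\beta)\|_{p,p}:=\sup_{\|\mathbf{x}\|_p=1}\|H(\alpha,\beta)\,\mathbf{x}\|_p=B\!\left(\alpha+\tfrac1p,\ \beta+\tfrac1q\right),$$ where $B(x,y)=\int_0^1t^{x-1}(1-t)^{y-1}\,dt$ for $x,y>0$. -/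

import Mathlib

open scoped ENNReal

/-- The Banach space `l^p` of complex sequences `(x_n)_{n ≥ 1}` with finite norm
`‖x‖_p = (∑ |x_n|^p)^{1/p}`, for a real exponent `p`. -/
abbrev SeqLp (p : ℝ) : Type := lp (fun _ : ℕ+ => ℂ) (ENNReal.ofReal p)

/-- The infinite matrix `C` acts on `l^p`: for every `x ∈ l^p` all the series
`(C x)_i = ∑_j c_{i,j} x_j` converge, and the sequence `C x` lies in `l^p` again. -/
def ActsOnLp (p : ℝ) (C : Matrix ℕ+ ℕ+ ℂ) : Prop :=
  ∀ x : SeqLp p, (∀ i, Summable fun j => C i j * x j) ∧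
    Memℓp (fun i => ∑' j, C i j * x j) (ENNReal.ofReal p)

/-- The sequence `C x ∈ l^p`. -/
noncomputable def ActsOnLp.mulVec {p : ℝ} {C : Matrix ℕ+ ℕ+ ℂ} (h : ActsOnLp p C)
    (x : SeqLp p) : SeqLp p :=
  ⟨fun i => ∑' j, C i j * x j, (h x).2⟩

/-- The operator norm `‖C‖_{p,p} = sup_{‖x‖_p = 1} ‖C x‖_p` of a matrix acting on `l^p`,
as an element of `[0, ∞]`, so that no boundedness is presupposed. -/
noncomputable def ActsOnLp.opNorm {p : ℝ} {C : Matrix ℕ+ ℕ+ ℂ} (h : ActsOnLp p C) : ℝ≥0∞ :=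
  ⨆ x : {x : SeqLp p // ‖x‖ = 1}, ENNReal.ofReal ‖h.mulVec x.1‖

/-- The matrix `H(α, β) = (i^α j^β / (i + j)^{α + β + 1})_{i, j ≥ 1}`. -/
noncomputable def hilbertMatrix (α β : ℝ) : Matrix ℕ+ ℕ+ ℂ :=
  fun i j => (((i : ℝ) ^ α * (j : ℝ) ^ β / ((i : ℝ) + (j : ℝ)) ^ (α + β + 1) : ℝ) : ℂ)

/-- The beta function `B(x, y) = ∫_0^1 t^{x-1} (1-t)^{y-1} dt`, for real `x, y > 0`. -/
noncomputable def realBeta (x y : ℝ) : ℝ :=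
  ∫ t in (0 : ℝ)..1, t ^ (x - 1) * (1 - t) ^ (y - 1)

/-!
Write `a = β + 1/q` and `b = α + 1/p`, so that `0 < a, b < 3` and the kernel
`x ^ α * y ^ β / (x + y) ^ (α + β + 1)` is `x ^ (b - 1/p) * y ^ (a - 1/q) / (x + y) ^ (a + b)`.

*Upper bound.* By the Schur test with weights `j ^ (-1/(pq))` (`tsum_rpow_le_of_row_col`) it suffices
that `∑ j, j ^ (a - 1) * (x + j) ^ (-(a + b))` is at most the integral
`∫ t ^ (a - 1) * (x + t) ^ (-(a + b)) = B(a, b) * x ^ (-b)` over `t > 0`, and the same with `a`, `b`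
interchanged. The integrand is not monotone for `a > 1`, so the comparison of sum and integral is not
immediate. But "the sum over `j ≥ 1` is at most the integral over `t > 0`" is stable under mixtures
(`SumLeIntegral.lintegral`), and for every `s < 2` and `r > 0` the function `t ^ s * (x + t) ^ (-r)`
is a mixture of the functions `t² * exp (-v t)`, by two Gamma integrals. For `t² * exp (-v t)` both
sides are explicit, and the comparison is Lazarević's inequality `cosh w ≤ (sinh w / w) ^ 3`
(`cube_mul_cosh_le_sinh_cube`). This is where `α, β ≤ 2` enters, through `a - 1, b - 1 < 2`.

*Lower bound.* Apply the matrix to `x_j = j ^ (-1/p)`, cut off at `j ≤ k M`. Since the kernel is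
homogeneous of degree `-1`, the `i`-th entry of the image is, for `i ≤ k`, at least `i ^ (-1/p)` times
the Riemann sum of mesh `1 / i` over `(0, M]` of a function with integral `B(a, b)` over `(0, ∞)`.
For any `c < B(a, b)` and suitable `M` this sum exceeds `c` for all large `i`
(`exists_eventually_lt_riemannSum`). So `c ^ p * (log k - O(1)) ≤ ‖H‖ ^ p * (log k + O(1))`, and
`k → ∞` gives `c ≤ ‖H‖` (`le_of_mul_harmonic_le`).
-/

open MeasureTheory Set Filter Topology

/-! ### The sum over the integers and the integral of `t² exp (-v t)` -/

/-- Lazarević's inequality `cosh w ≤ (sinh w / w) ^ 3`. It holds because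
`sinh w * cosh w ^ (-1/3) - w` is nondecreasing: with `cosh w = e ^ 3` its derivative is
`(e² - 1)² (2e² + 1) / (3e⁴)`. -/
theorem cube_mul_cosh_le_sinh_cube {w : ℝ} (hw : 0 ≤ w) :
    w ^ 3 * Real.cosh w ≤ Real.sinh w ^ 3 := by
  have hd : ∀ x : ℝ, HasDerivAt (fun x => Real.sinh x * Real.cosh x ^ (-(1 / 3) : ℝ) - x)
      (Real.cosh x * Real.cosh x ^ (-(1 / 3) : ℝ) +
        Real.sinh x * (Real.sinh x * (-(1 / 3)) * Real.cosh x ^ (-(1 / 3) - 1 : ℝ)) - 1) x :=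
    fun x => ((Real.hasDerivAt_sinh x).mul ((Real.hasDerivAt_cosh x).rpow_const
      (Or.inl (Real.cosh_pos x).ne'))).sub (hasDerivAt_id x)
  -- With `e = cosh x ^ (1/3)` the derivative is a rational function of `e` alone.
  have hmono : Monotone fun x => Real.sinh x * Real.cosh x ^ (-(1 / 3) : ℝ) - x := by
    refine monotone_of_deriv_nonneg (fun x => (hd x).differentiableAt) fun x => ?_
    rw [(hd x).deriv]
    have hc := Real.cosh_pos x
    obtain ⟨e, he, hce⟩ : ∃ e : ℝ, 0 < e ∧ Real.cosh x = e ^ 3 :=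
      ⟨Real.cosh x ^ (1 / 3 : ℝ), by positivity, by
        rw [← Real.rpow_natCast, ← Real.rpow_mul hc.le]; norm_num⟩
    have h1 : Real.cosh x ^ (-(1 / 3) : ℝ) = e⁻¹ := by
      rw [hce, ← Real.rpow_natCast, ← Real.rpow_mul he.le, ← Real.rpow_neg_one]; norm_num
    have h2 : Real.cosh x ^ (-(1 / 3) - 1 : ℝ) = e⁻¹ / e ^ 3 := by
      rw [Real.rpow_sub hc, h1, Real.rpow_one, hce]
    have hs : Real.sinh x ^ 2 = e ^ 6 - 1 := by
      rw [Real.sinh_sq, hce]; ring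
    have h3 : Real.cosh x * Real.cosh x ^ (-(1 / 3) : ℝ) +
        Real.sinh x * (Real.sinh x * (-(1 / 3)) * Real.cosh x ^ (-(1 / 3) - 1 : ℝ)) - 1 =
        (e ^ 2 - 1) ^ 2 * (2 * e ^ 2 + 1) / (3 * e ^ 4) := by
      rw [h1, h2, hce]
      calc _ = e ^ 3 * e⁻¹ - 1 / 3 * Real.sinh x ^ 2 * (e⁻¹ / e ^ 3) - 1 := by ring
        _ = _ := by
          rw [hs]
          field_simp
          ring
    rw [h3]
    positivity
  have h := hmono hw
  simp only [Real.sinh_zero, zero_mul, sub_zero] at h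
  have hc := Real.cosh_pos w
  have h' : w ≤ Real.sinh w * Real.cosh w ^ (-(1 / 3) : ℝ) := by linarith
  have h3 : w ^ 3 ≤ Real.sinh w ^ 3 * (Real.cosh w)⁻¹ := by
    calc w ^ 3 ≤ (Real.sinh w * Real.cosh w ^ (-(1 / 3) : ℝ)) ^ 3 := pow_le_pow_left₀ hw h' 3
      _ = _ := by
        rw [mul_pow, ← Real.rpow_natCast (Real.cosh w ^ _), ← Real.rpow_mul hc.le,
          ← Real.rpow_neg_one]
        norm_num
  calc _ ≤ Real.sinh w ^ 3 * (Real.cosh w)⁻¹ * Real.cosh w :=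
        mul_le_mul_of_nonneg_right h3 hc.le
    _ = _ := by field_simp

theorem hasSum_sq_mul_geometric {r : ℝ} (hr : ‖r‖ < 1) :
    HasSum (fun n : ℕ => ((n : ℝ) + 1) ^ 2 * r ^ (n + 1)) (r * (1 + r) / (1 - r) ^ 3) := by
  have h2 := hasSum_choose_mul_geometric_of_norm_lt_one 2 hr
  have h1 := hasSum_choose_mul_geometric_of_norm_lt_one 1 hr
  have hne : (1 - r) ≠ 0 := by
    rw [Real.norm_eq_abs, abs_lt] at hr
    linarith
  have h := ((h2.mul_left 2).sub h1).mul_left r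
  have e (n : ℕ) : r * (2 * (((n + 2).choose 2 : ℕ) * r ^ n) - ((n + 1).choose 1 : ℕ) * r ^ n) =
      ((n : ℝ) + 1) ^ 2 * r ^ (n + 1) := by
    have e2 : (((n + 2).choose 2 : ℕ) : ℝ) = ((n : ℝ) + 2) * (n + 1) / 2 := by
      rw [Nat.cast_choose_two]; push_cast; ring
    rw [e2, Nat.choose_one_right]
    push_cast
    ring
  have e' : r * (2 * (1 / (1 - r) ^ (2 + 1)) - 1 / (1 - r) ^ (1 + 1)) =
      r * (1 + r) / (1 - r) ^ 3 := by
    field_simp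
    ring
  simp only [e, e'] at h
  exact h

/-- The left side is `∑ j, j² exp (-v j)` over `j ≥ 1`, the right side `∫ t² exp (-v t)` over
`t > 0`. With `w = v / 2` this is `cube_mul_cosh_le_sinh_cube`. -/
theorem sq_geometric_le {v : ℝ} (hv : 0 < v) :
    Real.exp (-v) * (1 + Real.exp (-v)) / (1 - Real.exp (-v)) ^ 3 ≤ 2 / v ^ 3 := by
  have h := cube_mul_cosh_le_sinh_cube (w := v / 2) (by positivity)
  rw [Real.cosh_eq, Real.sinh_eq] at h
  set e := Real.exp (-(v / 2)) with he
  have hepos : 0 < e := Real.exp_pos _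
  have he1 : e < 1 := by rw [he, Real.exp_lt_one_iff]; linarith
  have e1 : Real.exp (v / 2) = e⁻¹ := by rw [he, Real.exp_neg, inv_inv]
  have e2 : Real.exp (-v) = e ^ 2 := by rw [he, ← Real.exp_nat_mul]; congr 1; push_cast; ring
  rw [e1] at h
  rw [e2]
  have hpos : 0 < 1 - e ^ 2 := by nlinarith
  rw [div_le_div_iff₀ (by positivity) (by positivity)]
  have h4 : e ^ 3 * ((v / 2) ^ 3 * ((e⁻¹ + e) / 2)) ≤ e ^ 3 * ((e⁻¹ - e) / 2) ^ 3 :=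
    mul_le_mul_of_nonneg_left h (by positivity)
  have l1 : e ^ 3 * ((v / 2) ^ 3 * ((e⁻¹ + e) / 2)) = e ^ 2 * (1 + e ^ 2) * v ^ 3 / 16 := by
    field_simp; ring
  have l2 : e ^ 3 * ((e⁻¹ - e) / 2) ^ 3 = (1 - e ^ 2) ^ 3 / 8 := by
    field_simp
    norm_num
  rw [l1, l2] at h4
  linarith

/-! ### Functions whose sum is at most their integral -/

theorem lintegral_rpow_mul_exp_neg_mul_Ioi {a v : ℝ} (ha : 0 < a) (hv : 0 < v) :
    ∫⁻ t in Ioi (0 : ℝ), ENNReal.ofReal (t ^ (a - 1) * Real.exp (-(v * t))) =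
      ENNReal.ofReal (Real.Gamma a * v ^ (-a)) := by
  have h := Real.integral_rpow_mul_exp_neg_mul_Ioi ha hv
  have hG := Real.Gamma_pos_of_pos ha
  rw [← ofReal_integral_eq_lintegral_ofReal, h]
  · congr 1
    rw [one_div, Real.inv_rpow hv.le, ← Real.rpow_neg hv.le, mul_comm]
  · -- The Bochner integral of a non-integrable function is `0`, but this one is positive.
    by_contra hn
    rw [integral_undef hn] at h
    have : 0 < (1 / v) ^ a * Real.Gamma a := by positivity
    linarith
  · filter_upwards [ae_restrict_mem measurableSet_Ioi] with t ht
    have : 0 < t := ht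
    positivity

/-- The sum of `f` over the positive integers is at most its integral over `(0, ∞)`. -/
def SumLeIntegral (f : ℝ → ℝ≥0∞) : Prop :=
  ∑' j : ℕ+, f j ≤ ∫⁻ t in Ioi (0 : ℝ), f t

theorem SumLeIntegral.congr {f g : ℝ → ℝ≥0∞} (hf : SumLeIntegral f)
    (h : ∀ t, 0 < t → f t = g t) : SumLeIntegral g := by
  have h1 : ∑' j : ℕ+, f j = ∑' j : ℕ+, g j :=
    tsum_congr fun j => h j (by exact_mod_cast j.pos)
  have h2 : ∫⁻ t in Ioi (0 : ℝ), f t = ∫⁻ t in Ioi (0 : ℝ), g t :=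
    setLIntegral_congr_fun measurableSet_Ioi fun t ht => h t ht
  rw [SumLeIntegral, ← h1, ← h2]
  exact hf

/-- The property `SumLeIntegral` passes to mixtures, by Tonelli. -/
theorem SumLeIntegral.lintegral {F : ℝ → ℝ → ℝ≥0∞} (hF : Measurable (Function.uncurry F))
    (h : ∀ x, 0 < x → SumLeIntegral (F x)) :
    SumLeIntegral fun t => ∫⁻ x in Ioi (0 : ℝ), F x t := by
  have hs : ∫⁻ t in Ioi (0 : ℝ), ∫⁻ x in Ioi (0 : ℝ), F x t =
      ∫⁻ x in Ioi (0 : ℝ), ∫⁻ t in Ioi (0 : ℝ), F x t :=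
    (lintegral_lintegral_swap hF.aemeasurable).symm
  rw [SumLeIntegral, ← lintegral_tsum fun j => (hF.of_uncurry_right).aemeasurable, hs]
  exact setLIntegral_mono' measurableSet_Ioi h

theorem SumLeIntegral.const_mul {f : ℝ → ℝ≥0∞} (hf : SumLeIntegral f) {c : ℝ≥0∞}
    (hc : c ≠ ∞) : SumLeIntegral fun t => c * f t := by
  unfold SumLeIntegral
  rw [ENNReal.tsum_mul_left, lintegral_const_mul' _ _ hc]
  exact mul_le_mul_right hf c

theorem sumLeIntegral_sq_mul_exp {v : ℝ} (hv : 0 < v) :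
    SumLeIntegral fun t => ENNReal.ofReal (t ^ 2 * Real.exp (-(v * t))) := by
  have hr : ‖Real.exp (-v)‖ < 1 := by
    rw [Real.norm_eq_abs, abs_of_pos (Real.exp_pos _), Real.exp_lt_one_iff]; linarith
  have hs := hasSum_sq_mul_geometric hr
  have e (n : ℕ) : (((n + 1 : ℕ) : ℝ)) ^ 2 * Real.exp (-(v * ((n + 1 : ℕ) : ℝ))) =
      ((n : ℝ) + 1) ^ 2 * Real.exp (-v) ^ (n + 1) := by
    rw [← Real.exp_nat_mul]; push_cast; ring_nf
  have h2 := lintegral_rpow_mul_exp_neg_mul_Ioi (a := 3) (by norm_num) hv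
  have h3 : ∀ t : ℝ, t ^ ((3 : ℝ) - 1) = t ^ 2 := fun t => by
    rw [← Real.rpow_natCast]; norm_num
  simp only [h3] at h2
  have hG : Real.Gamma 3 = 2 := by norm_num [Nat.factorial]
  unfold SumLeIntegral
  rw [h2, tsum_pnat_eq_tsum_succ
    (f := fun n : ℕ => ENNReal.ofReal ((n : ℝ) ^ 2 * Real.exp (-(v * (n : ℝ)))))]
  simp only [e]
  rw [← ENNReal.ofReal_tsum_of_nonneg (fun n => by positivity) hs.summable, hs.tsum_eq]
  refine ENNReal.ofReal_le_ofReal ((sq_geometric_le hv).trans_eq ?_)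
  rw [hG, Real.rpow_neg hv.le]
  norm_cast

/-- For `s < 2`, `t ^ s * exp (-v t)` is a mixture of the functions `t² exp (-(v + x) t)`, `x > 0`,
since `t ^ (s - 2)` is the Laplace transform of `x ^ (1 - s) / Γ(2 - s)`. -/
theorem sumLeIntegral_rpow_mul_exp {s v : ℝ} (hs : s < 2) (hv : 0 < v) :
    SumLeIntegral fun t => ENNReal.ofReal (t ^ s * Real.exp (-(v * t))) := by
  have hG := Real.Gamma_pos_of_pos (sub_pos.2 hs)
  have h := SumLeIntegral.lintegral
    (F := fun x t => ENNReal.ofReal (x ^ (1 - s)) *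
      ENNReal.ofReal (t ^ 2 * Real.exp (-((v + x) * t)))) (by fun_prop)
    fun x hx => (sumLeIntegral_sq_mul_exp (add_pos hv hx)).const_mul ENNReal.ofReal_ne_top
  refine (h.const_mul (c := ENNReal.ofReal (Real.Gamma (2 - s))⁻¹) ENNReal.ofReal_ne_top).congr
    fun t ht => ?_
  have e : ∫⁻ x in Ioi (0 : ℝ), ENNReal.ofReal (x ^ (1 - s)) *
      ENNReal.ofReal (t ^ 2 * Real.exp (-((v + x) * t))) =
      ENNReal.ofReal (t ^ 2 * Real.exp (-(v * t))) *
        ENNReal.ofReal (Real.Gamma (2 - s) * t ^ (-(2 - s))) := by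
    rw [← lintegral_rpow_mul_exp_neg_mul_Ioi (sub_pos.2 hs) ht,
      ← lintegral_const_mul' _ _ ENNReal.ofReal_ne_top]
    refine setLIntegral_congr_fun measurableSet_Ioi fun x hx => ?_
    have hx : 0 < x := hx
    rw [← ENNReal.ofReal_mul (by positivity), ← ENNReal.ofReal_mul (by positivity)]
    congr 1
    rw [show -((v + x) * t) = -(v * t) + -(t * x) by ring, Real.exp_add,
      show (2 - s - 1 : ℝ) = 1 - s by ring]
    ring
  rw [e, ← ENNReal.ofReal_mul (by positivity), ← ENNReal.ofReal_mul (by positivity)]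
  congr 1
  rw [show -(2 - s) = s - 2 by ring, Real.rpow_sub ht]
  norm_cast
  field_simp

theorem lintegral_rpow_mul_exp_add {r x t : ℝ} (hr : 0 < r) (hx : 0 < x) (ht : 0 < t) :
    ∫⁻ v in Ioi (0 : ℝ), ENNReal.ofReal (v ^ (r - 1) * Real.exp (-(x * v))) *
      ENNReal.ofReal (Real.exp (-(v * t))) =
      ENNReal.ofReal (Real.Gamma r * (x + t) ^ (-r)) := by
  rw [← lintegral_rpow_mul_exp_neg_mul_Ioi hr (add_pos hx ht)]
  refine setLIntegral_congr_fun measurableSet_Ioi fun v hv => ?_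
  have hv : 0 < v := hv
  rw [← ENNReal.ofReal_mul (by positivity), mul_assoc, ← Real.exp_add]
  congr 3
  ring_nf

/-- The Gamma integral for `(x + t) ^ (-r)` writes `t ^ s * (x + t) ^ (-r)` as a mixture of the
functions `t ^ s * exp (-v t)`, `v > 0`. -/
theorem rpow_mul_rpow_neg_eq_lintegral {s r x t : ℝ} (hr : 0 < r) (hx : 0 < x) (ht : 0 < t) :
    ENNReal.ofReal (t ^ s * (x + t) ^ (-r)) = ENNReal.ofReal (Real.Gamma r)⁻¹ *
      ∫⁻ v in Ioi (0 : ℝ), ENNReal.ofReal (v ^ (r - 1) * Real.exp (-(x * v))) *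
        ENNReal.ofReal (t ^ s * Real.exp (-(v * t))) := by
  have hG := Real.Gamma_pos_of_pos hr
  have e : ∫⁻ v in Ioi (0 : ℝ), ENNReal.ofReal (v ^ (r - 1) * Real.exp (-(x * v))) *
        ENNReal.ofReal (t ^ s * Real.exp (-(v * t))) =
      ENNReal.ofReal (t ^ s) * ENNReal.ofReal (Real.Gamma r * (x + t) ^ (-r)) := by
    rw [← lintegral_rpow_mul_exp_add hr hx ht, ← lintegral_const_mul' _ _ ENNReal.ofReal_ne_top]
    refine lintegral_congr fun v => ?_
    rw [ENNReal.ofReal_mul (p := t ^ s) (by positivity)]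
    ring
  rw [e, ← ENNReal.ofReal_mul (by positivity), ← ENNReal.ofReal_mul (by positivity)]
  congr 1
  field_simp

theorem sumLeIntegral_rpow_mul_rpow_neg {s r x : ℝ} (hs : s < 2) (hr : 0 < r) (hx : 0 < x) :
    SumLeIntegral fun t => ENNReal.ofReal (t ^ s * (x + t) ^ (-r)) := by
  have h := SumLeIntegral.lintegral
    (F := fun v t => ENNReal.ofReal (v ^ (r - 1) * Real.exp (-(x * v))) *
        ENNReal.ofReal (t ^ s * Real.exp (-(v * t)))) (by fun_prop)
    fun v hv => (sumLeIntegral_rpow_mul_exp hs hv).const_mul ENNReal.ofReal_ne_top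
  exact (h.const_mul (c := ENNReal.ofReal (Real.Gamma r)⁻¹) ENNReal.ofReal_ne_top).congr
    fun t ht => (rpow_mul_rpow_neg_eq_lintegral hr hx ht).symm

/-! ### The beta integral -/

theorem realBeta_eq {a b : ℝ} (ha : 0 < a) (hb : 0 < b) :
    realBeta a b = Real.Gamma a * Real.Gamma b / Real.Gamma (a + b) := by
  have h := ProbabilityTheory.beta_eq_betaIntegralReal a b ha hb
  rw [ProbabilityTheory.beta] at h
  rw [h, Complex.betaIntegral, realBeta]
  have e : ∫ x in (0 : ℝ)..1, (x : ℂ) ^ ((a : ℂ) - 1) * (1 - (x : ℂ)) ^ ((b : ℂ) - 1) =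
      ∫ x in (0 : ℝ)..1, ((x ^ (a - 1) * (1 - x) ^ (b - 1) : ℝ) : ℂ) := by
    refine intervalIntegral.integral_congr fun x hx => ?_
    rw [uIcc_of_le zero_le_one] at hx
    rw [Complex.ofReal_mul, Complex.ofReal_cpow hx.1, Complex.ofReal_cpow (sub_nonneg.2 hx.2)]
    push_cast
    rfl
  rw [e, intervalIntegral.integral_ofReal, Complex.ofReal_re]

theorem realBeta_comm {a b : ℝ} (ha : 0 < a) (hb : 0 < b) : realBeta a b = realBeta b a := by
  rw [realBeta_eq ha hb, realBeta_eq hb ha, add_comm, mul_comm]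

/-- Beta's integral over the half-line, from the mixture representation of the integrand and two
Gamma integrals. -/
theorem lintegral_rpow_mul_rpow_neg {a b x : ℝ} (ha : 0 < a) (hb : 0 < b) (hx : 0 < x) :
    ∫⁻ t in Ioi (0 : ℝ), ENNReal.ofReal (t ^ (a - 1) * (x + t) ^ (-(a + b))) =
      ENNReal.ofReal (realBeta a b * x ^ (-b)) := by
  have hG := Real.Gamma_pos_of_pos ha
  have hG' := Real.Gamma_pos_of_pos (add_pos ha hb)
  have e1 : ∫⁻ t in Ioi (0 : ℝ), ENNReal.ofReal (t ^ (a - 1) * (x + t) ^ (-(a + b))) =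
      ∫⁻ t in Ioi (0 : ℝ), ENNReal.ofReal (Real.Gamma (a + b))⁻¹ *
      ∫⁻ v in Ioi (0 : ℝ), ENNReal.ofReal (v ^ (a + b - 1) * Real.exp (-(x * v))) *
        ENNReal.ofReal (t ^ (a - 1) * Real.exp (-(v * t))) :=
    setLIntegral_congr_fun measurableSet_Ioi fun t ht =>
      rpow_mul_rpow_neg_eq_lintegral (add_pos ha hb) hx ht
  have e2 : ∫⁻ v in Ioi (0 : ℝ), ∫⁻ t in Ioi (0 : ℝ),
        ENNReal.ofReal (v ^ (a + b - 1) * Real.exp (-(x * v))) *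
        ENNReal.ofReal (t ^ (a - 1) * Real.exp (-(v * t))) =
      ∫⁻ v in Ioi (0 : ℝ), ENNReal.ofReal (Real.Gamma a) *
        ENNReal.ofReal (v ^ (b - 1) * Real.exp (-(x * v))) := by
    refine setLIntegral_congr_fun measurableSet_Ioi fun v hv => ?_
    have hv : 0 < v := hv
    rw [lintegral_const_mul' _ _ ENNReal.ofReal_ne_top, lintegral_rpow_mul_exp_neg_mul_Ioi ha hv,
      ← ENNReal.ofReal_mul (by positivity), ← ENNReal.ofReal_mul (by positivity)]
    congr 1
    rw [show b - 1 = (a + b - 1) + -a by ring, Real.rpow_add hv]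
    ring
  rw [e1, lintegral_const_mul' _ _ ENNReal.ofReal_ne_top,
    lintegral_lintegral_swap (by fun_prop), e2, lintegral_const_mul' _ _ ENNReal.ofReal_ne_top,
    lintegral_rpow_mul_exp_neg_mul_Ioi hb hx, ← ENNReal.ofReal_mul (by positivity),
    ← ENNReal.ofReal_mul (by positivity), realBeta_eq ha hb]
  congr 1
  ring

/-- The bound for the row sums, and by symmetry for the column sums, of the weighted matrix. The
function summed need not be monotone: it is not when `a > 1`. -/
theorem tsum_rpow_mul_rpow_neg_le {a b x : ℝ} (ha : 0 < a) (ha3 : a < 3) (hb : 0 < b)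
    (hx : 0 < x) :
    ∑' j : ℕ+, ENNReal.ofReal ((j : ℝ) ^ (a - 1) * (x + j) ^ (-(a + b))) ≤
      ENNReal.ofReal (realBeta a b * x ^ (-b)) := by
  rw [← lintegral_rpow_mul_rpow_neg ha hb hx]
  exact sumLeIntegral_rpow_mul_rpow_neg (by linarith) (add_pos ha hb) hx

/-! ### The Schur test -/

/-- The Schur test: a matrix `a ^ (1/q) * b ^ (1/p)`, where `a` has row sums and `b` has column sums
at most `G`, has norm at most `G` on `ℓ^p`. -/
theorem tsum_rpow_le_of_row_col {ι κ : Type*} {p q : ℝ} (hpq : p.HolderConjugate q)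
    {a b : ι → κ → ℝ≥0∞} {G : ℝ≥0∞} (ha : ∀ i, ∑' j, a i j ≤ G) (hb : ∀ j, ∑' i, b i j ≤ G)
    (X : κ → ℝ≥0∞) :
    ∑' i, (∑' j, a i j ^ (1 / q) * b i j ^ (1 / p) * X j) ^ p ≤ G ^ p * ∑' j, X j ^ p := by
  have hp := hpq.pos
  have hq := hpq.symm.pos
  have hrow (i : ι) : (∑' j, a i j ^ (1 / q) * b i j ^ (1 / p) * X j) ^ p ≤
      G ^ (p / q) * ∑' j, b i j * X j ^ p := by
    let _ : MeasurableSpace κ := ⊤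
    have h := ENNReal.lintegral_mul_le_Lp_mul_Lq (Measure.count : Measure κ) hpq.symm
      (f := fun j => a i j ^ (1 / q)) (g := fun j => b i j ^ (1 / p) * X j)
      measurable_from_top.aemeasurable measurable_from_top.aemeasurable
    simp only [lintegral_count, Pi.mul_apply] at h
    have e1 (j : κ) : (a i j ^ (1 / q)) ^ q = a i j := by
      rw [← ENNReal.rpow_mul, one_div_mul_cancel hq.ne', ENNReal.rpow_one]
    have e2 (j : κ) : (b i j ^ (1 / p) * X j) ^ p = b i j * X j ^ p := by
      rw [ENNReal.mul_rpow_of_nonneg _ _ hp.le, ← ENNReal.rpow_mul,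
        one_div_mul_cancel hp.ne', ENNReal.rpow_one]
    simp only [e1, e2] at h
    calc (∑' j, a i j ^ (1 / q) * b i j ^ (1 / p) * X j) ^ p
        ≤ ((∑' j, a i j) ^ (1 / q) * (∑' j, b i j * X j ^ p) ^ (1 / p)) ^ p := by
          refine ENNReal.rpow_le_rpow ?_ hp.le
          simpa only [mul_assoc] using h
      _ = (∑' j, a i j) ^ (p / q) * ∑' j, b i j * X j ^ p := by
          rw [ENNReal.mul_rpow_of_nonneg _ _ hp.le, ← ENNReal.rpow_mul, ← ENNReal.rpow_mul,
            one_div_mul_cancel hp.ne', ENNReal.rpow_one, one_div_mul_eq_div]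
      _ ≤ _ := by
          gcongr
          exact ha i
  calc ∑' i, (∑' j, a i j ^ (1 / q) * b i j ^ (1 / p) * X j) ^ p
      ≤ ∑' i, G ^ (p / q) * ∑' j, b i j * X j ^ p := ENNReal.tsum_le_tsum hrow
    _ = G ^ (p / q) * ∑' j, (∑' i, b i j) * X j ^ p := by
        rw [ENNReal.tsum_mul_left, ENNReal.tsum_comm]
        simp only [ENNReal.tsum_mul_right]
    _ ≤ G ^ (p / q) * ∑' j, G * X j ^ p := by
        gcongr with j
        exact hb j
    _ = G ^ p * ∑' j, X j ^ p := by
        rw [ENNReal.tsum_mul_left, ← mul_assoc]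
        congr 1
        nth_rewrite 2 [← ENNReal.rpow_one G]
        rw [← ENNReal.rpow_add_of_nonneg _ _ (by positivity) zero_le_one]
        congr 1
        have := hpq.div_conj_eq_sub_one
        linarith

/-! ### Matrices acting on `l^p` -/

theorem ofReal_norm_rpow_eq_tsum {p : ℝ} (hp : 0 < p) (x : SeqLp p) :
    ENNReal.ofReal ‖x‖ ^ p = ∑' i, ENNReal.ofReal ‖x i‖ ^ p := by
  have hp' : (ENNReal.ofReal p).toReal = p := ENNReal.toReal_ofReal hp.le
  have h := lp.norm_rpow_eq_tsum (p := ENNReal.ofReal p) (hp'.symm ▸ hp) x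
  have hs := (lp.memℓp x).summable (hp'.symm ▸ hp)
  rw [hp'] at h hs
  rw [ENNReal.ofReal_rpow_of_nonneg (lp.norm_nonneg' x) hp.le, h,
    ENNReal.ofReal_tsum_of_nonneg (fun i => by positivity) hs]
  exact tsum_congr fun i => (ENNReal.ofReal_rpow_of_nonneg (norm_nonneg _) hp.le).symm

theorem summable_of_tsum_ofReal_ne_top {ι : Type*} {f : ι → ℝ} (hf : ∀ i, 0 ≤ f i)
    (h : ∑' i, ENNReal.ofReal (f i) ≠ ∞) : Summable f := by
  have := ENNReal.summable_toReal h
  simpa only [ENNReal.toReal_ofReal (hf _)] using this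

/-- An `ℓ^p` bound for the matrix of absolute values, stated for extended nonnegative sequences,
contains the convergence of all the series `∑ j, C i j * x j`. -/
theorem exists_actsOnLp_of_tsum_le {p : ℝ} (hp : 1 < p) {C : Matrix ℕ+ ℕ+ ℂ} {G : ℝ}
    (hC : ∀ X : ℕ+ → ℝ≥0∞, ∑' i, (∑' j, ENNReal.ofReal ‖C i j‖ * X j) ^ p ≤
      ENNReal.ofReal G ^ p * ∑' j, X j ^ p) :
    ∃ h : ActsOnLp p C, h.opNorm ≤ ENNReal.ofReal G := by
  have hp0 : 0 < p := by linarith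
  have hp' : (ENNReal.ofReal p).toReal = p := ENNReal.toReal_ofReal hp0.le
  have hle (x : SeqLp p) := hC fun j => ENNReal.ofReal ‖x j‖
  simp only [← ofReal_norm_rpow_eq_tsum hp0] at hle
  have hfin (x : SeqLp p) := ne_top_of_le_ne_top
    (ENNReal.mul_ne_top (ENNReal.rpow_ne_top_of_nonneg hp0.le ENNReal.ofReal_ne_top)
      (ENNReal.rpow_ne_top_of_nonneg hp0.le ENNReal.ofReal_ne_top)) (hle x)
  have hrow (x : SeqLp p) (i : ℕ+) : ∑' j, ENNReal.ofReal (‖C i j * x j‖) ≠ ∞ := by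
    have h := ENNReal.ne_top_of_tsum_ne_top (hfin x) i
    simp only [norm_mul, ENNReal.ofReal_mul (norm_nonneg _)]
    intro h'
    rw [h', ENNReal.top_rpow_of_pos hp0] at h
    exact h rfl
  have hsum (x : SeqLp p) (i : ℕ+) : Summable fun j => ‖C i j * x j‖ :=
    summable_of_tsum_ofReal_ne_top (fun _ => norm_nonneg _) (hrow x i)
  have hnorm (x : SeqLp p) (i : ℕ+) : ENNReal.ofReal ‖∑' j, C i j * x j‖ ≤
      ∑' j, ENNReal.ofReal ‖C i j‖ * ENNReal.ofReal ‖x j‖ := by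
    simp only [← ENNReal.ofReal_mul (norm_nonneg _), ← norm_mul]
    rw [← ENNReal.ofReal_tsum_of_nonneg (fun _ => norm_nonneg _) (hsum x i)]
    exact ENNReal.ofReal_le_ofReal (norm_tsum_le_tsum_norm (hsum x i))
  have hbound (x : SeqLp p) : ∑' i, ENNReal.ofReal ‖∑' j, C i j * x j‖ ^ p ≤
      ENNReal.ofReal G ^ p * ENNReal.ofReal ‖x‖ ^ p :=
    (ENNReal.tsum_le_tsum fun i => ENNReal.rpow_le_rpow (hnorm x i) hp0.le).trans (hle x)
  have hacts : ActsOnLp p C := fun x => by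
    refine ⟨fun i => (hsum x i).of_norm, (memℓp_gen_iff (hp'.symm ▸ hp0)).2 ?_⟩
    rw [hp']
    refine summable_of_tsum_ofReal_ne_top (fun _ => by positivity) ?_
    simp only [← ENNReal.ofReal_rpow_of_nonneg (norm_nonneg _) hp0.le]
    exact ne_top_of_le_ne_top
      (ENNReal.mul_ne_top (ENNReal.rpow_ne_top_of_nonneg hp0.le ENNReal.ofReal_ne_top)
        (ENNReal.rpow_ne_top_of_nonneg hp0.le ENNReal.ofReal_ne_top)) (hbound x)
  refine ⟨hacts, iSup_le fun x => ?_⟩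
  have h := hbound x.1
  rw [x.2, ENNReal.ofReal_one, ENNReal.one_rpow, mul_one] at h
  rw [← ENNReal.rpow_le_rpow_iff hp0, ofReal_norm_rpow_eq_tsum hp0]
  exact h

theorem ActsOnLp.norm_mulVec_le {p : ℝ} (hp : 1 < p) {C : Matrix ℕ+ ℕ+ ℂ} (h : ActsOnLp p C)
    (x : SeqLp p) (hx : x ≠ 0) :
    ENNReal.ofReal ‖h.mulVec x‖ ≤ h.opNorm * ENNReal.ofReal ‖x‖ := by
  have : Fact (1 ≤ ENNReal.ofReal p) := ⟨ENNReal.one_le_ofReal.2 hp.le⟩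
  have hx0 : 0 < ‖x‖ := norm_pos_iff.2 hx
  set y : SeqLp p := ((‖x‖⁻¹ : ℝ) : ℂ) • x with hy
  have hy1 : ‖y‖ = 1 := by
    rw [hy, norm_smul, Complex.norm_real, norm_inv, norm_norm, inv_mul_cancel₀ hx0.ne']
  have hxy : h.mulVec x = ((‖x‖ : ℝ) : ℂ) • h.mulVec y := by
    ext i
    change ∑' j, C i j * x j = ((‖x‖ : ℝ) : ℂ) * ∑' j, C i j * (((‖x‖⁻¹ : ℝ) : ℂ) * x j)
    rw [← tsum_mul_left]
    refine tsum_congr fun j => ?_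
    have : ((‖x‖ : ℝ) : ℂ) ≠ 0 := by exact_mod_cast hx0.ne'
    push_cast
    field_simp
  rw [hxy, norm_smul, Complex.norm_real, norm_norm, ENNReal.ofReal_mul hx0.le, mul_comm]
  gcongr
  exact le_iSup (fun x : {x : SeqLp p // ‖x‖ = 1} => ENNReal.ofReal ‖h.mulVec x.1‖) ⟨y, hy1⟩

/-- The operator norm of a nonnegative matrix, tested on the nonnegative sequence `x` cut off outside
`s`, and with only the rows in `t` kept. -/
theorem ActsOnLp.sum_rpow_le {p : ℝ} (hp : 1 < p) {C : Matrix ℕ+ ℕ+ ℂ} (h : ActsOnLp p C)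
    {k : ℕ+ → ℕ+ → ℝ} (hC : ∀ i j, C i j = k i j) (hk : ∀ i j, 0 ≤ k i j)
    {x : ℕ+ → ℝ} (hx : ∀ j, 0 ≤ x j) (s t : Finset ℕ+) :
    ∑ i ∈ t, ENNReal.ofReal (∑ j ∈ s, k i j * x j) ^ p ≤
      h.opNorm ^ p * ∑ j ∈ s, ENNReal.ofReal (x j) ^ p := by
  have hp0 : 0 < p := by linarith
  classical
  have hmem : Memℓp (fun j => if j ∈ s then (x j : ℂ) else 0) (ENNReal.ofReal p) := by
    refine (memℓp_zero ?_).of_exponent_ge zero_le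
    refine s.finite_toSet.subset fun j hj => ?_
    by_contra hjs
    exact hj (if_neg hjs)
  set y : SeqLp p := ⟨_, hmem⟩ with hy
  have hyj (j : ℕ+) : y j = if j ∈ s then (x j : ℂ) else 0 := rfl
  have hmul (i : ℕ+) : h.mulVec y i = ((∑ j ∈ s, k i j * x j : ℝ) : ℂ) := by
    change ∑' j, C i j * y j = _
    simp only [hC]
    rw [tsum_eq_sum (s := s) fun j hj => by rw [hyj, if_neg hj, mul_zero]]
    push_cast
    exact Finset.sum_congr rfl fun j hj => by rw [hyj, if_pos hj]
  have hyn : ENNReal.ofReal ‖y‖ ^ p = ∑ j ∈ s, ENNReal.ofReal (x j) ^ p := by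
    rw [ofReal_norm_rpow_eq_tsum hp0, tsum_eq_sum (s := s) fun j hj => by
      rw [hyj, if_neg hj, norm_zero, ENNReal.ofReal_zero, ENNReal.zero_rpow_of_pos hp0]]
    exact Finset.sum_congr rfl fun j hj => by
      rw [hyj, if_pos hj, Complex.norm_real, Real.norm_of_nonneg (hx j)]
  have hle : ENNReal.ofReal ‖h.mulVec y‖ ^ p ≤ h.opNorm ^ p * ENNReal.ofReal ‖y‖ ^ p := by
    rw [← ENNReal.mul_rpow_of_nonneg _ _ hp0.le]
    refine ENNReal.rpow_le_rpow ?_ hp0.le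
    rcases eq_or_ne y 0 with h0 | h0
    · have : h.mulVec y = 0 := by
        ext i
        change ∑' j, C i j * y j = 0
        simp [h0]
      rw [this, lp.norm_zero, ENNReal.ofReal_zero]
      exact zero_le
    · exact h.norm_mulVec_le hp y h0
  rw [hyn, ofReal_norm_rpow_eq_tsum hp0] at hle
  refine (Eq.le ?_).trans ((ENNReal.sum_le_tsum t).trans hle)
  refine Finset.sum_congr rfl fun i _ => ?_
  rw [hmul, Complex.norm_real,
    Real.norm_of_nonneg (Finset.sum_nonneg fun j _ => mul_nonneg (hk i j) (hx j))]

/-! ### Riemann sums and harmonic sums -/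

/-- Riemann sums of mesh `1 / n` for `∫ f` over `(0, ∞)`, cut off at a suitable fixed `M`, eventually
exceed any number below the integral. This is Fatou's lemma for the step functions
`t ↦ f (⌈t n⌉ / n)` on `(0, M]`, and needs no monotonicity or integrability at `0`. -/
theorem exists_eventually_lt_riemannSum {f : ℝ → ℝ≥0∞} (hf : Measurable f)
    (hfc : ContinuousOn f (Ioi 0)) {c : ℝ≥0∞} (hc : c < ∫⁻ t in Ioi (0 : ℝ), f t) :
    ∃ M : ℕ, 0 < M ∧ ∀ᶠ n : ℕ in atTop, c < ∑ j ∈ Finset.range (n * M),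
      ENNReal.ofReal (1 / n) * f (((j + 1 : ℕ) : ℝ) / n) := by
  have hU : Ioi (0 : ℝ) = ⋃ M : ℕ, Ioc (0 : ℝ) M := by
    ext t
    simp only [mem_Ioi, mem_iUnion, mem_Ioc, exists_and_left]
    exact ⟨fun h => ⟨h, exists_nat_ge t⟩, fun h => h.1⟩
  have hmono : Monotone fun M : ℕ => Ioc (0 : ℝ) M := fun m n h =>
    Ioc_subset_Ioc_right (by exact_mod_cast h)
  rw [hU, setLIntegral_iUnion_of_directed _ hmono.directed_le, lt_iSup_iff] at hc
  obtain ⟨M, hM⟩ := hc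
  have hM0 : 0 < M := by
    rcases Nat.eq_zero_or_pos M with rfl | h
    · simp at hM
    · exact h
  refine ⟨M, hM0, ?_⟩
  have hlim : ∀ t ∈ Ioc (0 : ℝ) M,
      f t = liminf (fun n : ℕ => f ((⌈t * n⌉₊ : ℝ) / n)) atTop := fun t ht => by
    refine (Tendsto.liminf_eq ?_).symm
    have h1 : Tendsto (fun n : ℕ => (⌈t * n⌉₊ : ℝ) / n) atTop (𝓝 t) :=
      (tendsto_nat_ceil_mul_div_atTop ht.1.le).comp tendsto_natCast_atTop_atTop
    exact (hfc.continuousAt (Ioi_mem_nhds ht.1)).tendsto.comp h1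
  rw [setLIntegral_congr_fun measurableSet_Ioc hlim] at hM
  have hM' := hM.trans_le (lintegral_liminf_le fun n : ℕ => by fun_prop)
  filter_upwards [eventually_lt_of_lt_liminf hM', eventually_gt_atTop 0] with n hn hn0
  have hn0' : (0 : ℝ) < n := by exact_mod_cast hn0
  refine hn.trans_le ?_
  -- On the interval `(j / n, (j + 1) / n]` the step function has the value `f ((j + 1) / n)`.
  have hsub : Ioc (0 : ℝ) M ⊆ ⋃ j : Fin (n * M), Ioc ((j : ℕ) / n : ℝ) (((j : ℕ) + 1 : ℕ) / n) := by
    intro t ht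
    have hpos : 0 < ⌈t * n⌉₊ := Nat.ceil_pos.2 (mul_pos ht.1 hn0')
    have hle : ⌈t * n⌉₊ ≤ n * M := Nat.ceil_le.2 (by
      push_cast
      rw [mul_comm]
      exact mul_le_mul_of_nonneg_left ht.2 hn0'.le)
    refine mem_iUnion.2 ⟨⟨⌈t * n⌉₊ - 1, by omega⟩, ?_, ?_⟩
    · rw [div_lt_iff₀ hn0']
      exact Nat.lt_ceil.1 (by simp only; omega)
    · rw [le_div_iff₀ hn0']
      simp only
      rw [Nat.sub_add_cancel hpos]
      exact Nat.le_ceil _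
  refine (lintegral_mono_set hsub).trans ((lintegral_iUnion_le _ _).trans_eq ?_)
  rw [tsum_fintype, ← Fin.sum_univ_eq_sum_range
    (fun j => ENNReal.ofReal (1 / n) * f (((j + 1 : ℕ) : ℝ) / n))]
  refine Finset.sum_congr rfl fun j _ => ?_
  have hconst : ∀ t ∈ Ioc ((j : ℕ) / n : ℝ) (((j : ℕ) + 1 : ℕ) / n),
      f ((⌈t * n⌉₊ : ℝ) / n) = f ((((j : ℕ) + 1 : ℕ) : ℝ) / n) := fun t ht => by
    have h1 := (div_lt_iff₀ hn0').1 ht.1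
    have h2 := (le_div_iff₀ hn0').1 ht.2
    have : ⌈t * n⌉₊ = (j : ℕ) + 1 :=
      le_antisymm (Nat.ceil_le.2 h2) (Nat.succ_le_of_lt (Nat.lt_ceil.2 h1))
    rw [this]
  rw [setLIntegral_congr_fun measurableSet_Ioc hconst, setLIntegral_const, Real.volume_Ioc,
    mul_comm]
  congr 2
  push_cast
  ring

/-- The harmonic sums up to `k * M` and up to `k` differ by at most `M`, whereas both tend to
infinity. -/
theorem le_of_mul_harmonic_le {A D : ℝ} (hD : 0 ≤ D) {M n₀ : ℕ} (hM : 0 < M)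
    (h : ∀ k, A * ∑ n ∈ Finset.Ico n₀ k, 1 / ((n : ℝ) + 1) ≤
      D * ∑ n ∈ Finset.range (k * M), 1 / ((n : ℝ) + 1)) : A ≤ D := by
  by_contra! hlt
  set H : ℕ → ℝ := fun k => ∑ n ∈ Finset.range k, 1 / ((n : ℝ) + 1) with hH
  have hHM (k : ℕ) (hk : 0 < k) : H (k * M) ≤ H k + M := by
    have hkM : k ≤ k * M := Nat.le_mul_of_pos_right k hM
    have hk' : (0 : ℝ) < k := by exact_mod_cast hk
    have h1 : H (k * M) = H k + ∑ n ∈ Finset.Ico k (k * M), 1 / ((n : ℝ) + 1) :=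
      (Finset.sum_range_add_sum_Ico _ hkM).symm
    have h2 : ∑ n ∈ Finset.Ico k (k * M), 1 / ((n : ℝ) + 1) ≤
        (Finset.Ico k (k * M)).card • (1 / (k : ℝ)) := by
      refine Finset.sum_le_card_nsmul _ _ _ fun n hn => ?_
      have : (k : ℝ) ≤ n := by exact_mod_cast (Finset.mem_Ico.1 hn).1
      exact one_div_le_one_div_of_le hk' (by linarith)
    have h3 : (Finset.Ico k (k * M)).card • (1 / (k : ℝ)) ≤ M := by
      rw [Nat.card_Ico, nsmul_eq_mul, mul_one_div, div_le_iff₀ hk', mul_comm]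
      exact_mod_cast Nat.sub_le _ _
    linarith
  have hkey : ∀ᶠ k in atTop, H k ≤ (D * M + A * H n₀) / (A - D) := by
    filter_upwards [eventually_ge_atTop n₀, eventually_gt_atTop 0] with k hk hk0
    have h1 := h k
    have h2 : H n₀ + ∑ n ∈ Finset.Ico n₀ k, 1 / ((n : ℝ) + 1) = H k :=
      Finset.sum_range_add_sum_Ico _ hk
    have h3 := mul_le_mul_of_nonneg_left (hHM k hk0) hD
    rw [le_div_iff₀ (sub_pos.2 hlt)]
    have h4 : ∑ n ∈ Finset.Ico n₀ k, 1 / ((n : ℝ) + 1) = H k - H n₀ := by linarith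
    rw [h4] at h1
    have h5 : A * (H k - H n₀) ≤ D * (H k + M) := h1.trans h3
    linarith
  have htend : Tendsto H atTop atTop := Real.tendsto_sum_range_one_div_nat_succ_atTop
  obtain ⟨k, h1, h2⟩ := (hkey.and (htend.eventually_gt_atTop _)).exists
  exact absurd h1 (not_le.2 h2)

/-! ### The norm of the generalized Hilbert matrix -/

/-- The splitting of the entries of the matrix that the Schur test uses. The factors are the entries
times `(x / y) ^ (1/p)` and times `(y / x) ^ (1/q)`. -/
theorem kernel_eq_schur {p q a b x y : ℝ} (hpq : p.HolderConjugate q) (hx : 0 < x) (hy : 0 < y) :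
    x ^ (b - 1 / p) * y ^ (a - 1 / q) / (x + y) ^ (a + b) =
      (x ^ b * (y ^ (a - 1) * (x + y) ^ (-(a + b)))) ^ (1 / q) *
        (y ^ a * (x ^ (b - 1) * (y + x) ^ (-(b + a)))) ^ (1 / p) := by
  have hxy : 0 < x + y := add_pos hx hy
  have e1 : 1 / q = 1 - 1 / p := by
    have := hpq.inv_add_inv_eq_one
    simp only [one_div]
    linarith
  rw [div_eq_mul_inv, ← Real.rpow_neg hxy.le, e1, add_comm y x, add_comm b a]
  simp only [Real.rpow_def_of_pos hx, Real.rpow_def_of_pos hy, Real.rpow_def_of_pos hxy,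
    ← Real.exp_add, Real.rpow_def_of_pos (Real.exp_pos _), Real.log_exp]
  congr 1
  ring

/-- The kernel is homogeneous of degree `-1`; applied to `j ^ (-1/p)` it gives `i ^ (-1/p)` times a
Riemann sum of mesh `1 / i`. -/
theorem kernel_mul_rpow_eq {p q a b x y : ℝ} (hpq : p.HolderConjugate q) (hx : 0 < x)
    (hy : 0 < y) :
    x ^ (b - 1 / p) * y ^ (a - 1 / q) / (x + y) ^ (a + b) * y ^ (-(1 / p)) =
      x ^ (-(1 / p)) * (1 / x * ((y / x) ^ (a - 1) * (1 + y / x) ^ (-(a + b)))) := by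
  have hxy : 0 < x + y := add_pos hx hy
  have e1 : 1 / q = 1 - 1 / p := by
    have := hpq.inv_add_inv_eq_one
    simp only [one_div]
    linarith
  have e2 : 1 + y / x = (x + y) / x := by field_simp
  have e3 : 1 / x = x ^ (-1 : ℝ) := by rw [Real.rpow_neg_one, one_div]
  rw [div_eq_mul_inv, ← Real.rpow_neg hxy.le, e1, e2, e3]
  simp only [Real.rpow_def_of_pos hx, Real.rpow_def_of_pos hy, Real.rpow_def_of_pos hxy,
    Real.rpow_def_of_pos (div_pos hy hx), Real.rpow_def_of_pos (div_pos hxy hx),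
    Real.log_div hy.ne' hx.ne', Real.log_div hxy.ne' hx.ne', ← Real.exp_add]
  congr 1
  ring

theorem hilbertMatrix_upper {p q a b : ℝ} (hpq : p.HolderConjugate q) (ha : 0 < a) (ha3 : a < 3)
    (hb : 0 < b) (hb3 : b < 3) :
    ∃ h : ActsOnLp p (hilbertMatrix (b - 1 / p) (a - 1 / q)),
      h.opNorm ≤ ENNReal.ofReal (realBeta a b) := by
  have hp := hpq.pos
  have hq := hpq.symm.pos
  refine exists_actsOnLp_of_tsum_le hpq.lt fun X => ?_
  have hexp : b - 1 / p + (a - 1 / q) + 1 = a + b := by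
    have := hpq.inv_add_inv_eq_one
    simp only [one_div]
    linarith
  set A : ℕ+ → ℕ+ → ℝ≥0∞ := fun i j => ENNReal.ofReal
    ((i : ℝ) ^ b * ((j : ℝ) ^ (a - 1) * ((i : ℝ) + j) ^ (-(a + b)))) with hA
  set B : ℕ+ → ℕ+ → ℝ≥0∞ := fun i j => ENNReal.ofReal
    ((j : ℝ) ^ a * ((i : ℝ) ^ (b - 1) * ((j : ℝ) + i) ^ (-(b + a)))) with hB
  have hpos (i : ℕ+) : (0 : ℝ) < i := by exact_mod_cast i.pos
  have hsum {a b : ℝ} (ha : 0 < a) (ha3 : a < 3) (hb : 0 < b) (i : ℕ+) :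
      ∑' j : ℕ+, ENNReal.ofReal
        ((i : ℝ) ^ b * ((j : ℝ) ^ (a - 1) * ((i : ℝ) + j) ^ (-(a + b)))) ≤
        ENNReal.ofReal (realBeta a b) := by
    have hi := hpos i
    simp only [ENNReal.ofReal_mul (Real.rpow_nonneg hi.le b)]
    rw [ENNReal.tsum_mul_left]
    refine (mul_le_mul_right (tsum_rpow_mul_rpow_neg_le ha ha3 hb hi) _).trans_eq ?_
    rw [← ENNReal.ofReal_mul (by positivity), mul_left_comm, ← Real.rpow_add hi, add_neg_cancel,
      Real.rpow_zero, mul_one]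
  have hC (i j : ℕ+) : ENNReal.ofReal ‖hilbertMatrix (b - 1 / p) (a - 1 / q) i j‖ =
      A i j ^ (1 / q) * B i j ^ (1 / p) := by
    have hi := hpos i
    have hj := hpos j
    rw [hA, hB]
    simp only
    rw [ENNReal.ofReal_rpow_of_nonneg (by positivity) (by positivity),
      ENNReal.ofReal_rpow_of_nonneg (by positivity) (by positivity),
      ← ENNReal.ofReal_mul (by positivity), ← kernel_eq_schur hpq hi hj, hilbertMatrix,
      Complex.norm_real, hexp, Real.norm_of_nonneg (by positivity)]
  simp only [hC]
  refine tsum_rpow_le_of_row_col hpq (fun i => hsum ha ha3 hb i) (fun j => ?_) X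
  rw [realBeta_comm ha hb]
  exact hsum hb hb3 ha j

theorem hilbertMatrix_lower {p q a b : ℝ} (hpq : p.HolderConjugate q) (ha : 0 < a) (hb : 0 < b)
    (h : ActsOnLp p (hilbertMatrix (b - 1 / p) (a - 1 / q))) :
    ENNReal.ofReal (realBeta a b) ≤ h.opNorm := by
  have hp := hpq.pos
  have hexp : b - 1 / p + (a - 1 / q) + 1 = a + b := by
    have := hpq.inv_add_inv_eq_one
    simp only [one_div]
    linarith
  by_cases htop : h.opNorm = ∞
  · rw [htop]
    exact le_top
  refine le_of_forall_lt_imp_le_of_dense fun c hc => ?_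
  have hctop : c ≠ ∞ := hc.ne_top
  have hTp : h.opNorm ^ p ≠ ∞ := ENNReal.rpow_ne_top_of_nonneg hp.le htop
  have hcp : c ^ p ≠ ∞ := ENNReal.rpow_ne_top_of_nonneg hp.le hctop
  set f : ℝ → ℝ≥0∞ := fun t => ENNReal.ofReal (t ^ (a - 1) * (1 + t) ^ (-(a + b))) with hf
  have hfc : ContinuousOn f (Ioi 0) := by
    refine ENNReal.continuous_ofReal.comp_continuousOn fun t ht => ?_
    have ht : 0 < t := ht
    refine ContinuousAt.continuousWithinAt (ContinuousAt.mul ?_ ?_)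
    · exact Real.continuousAt_rpow_const _ _ (Or.inl ht.ne')
    · exact (continuousAt_const.add continuousAt_id).rpow_const (Or.inl (by simp; linarith))
  have hint : ∫⁻ t in Ioi (0 : ℝ), f t = ENNReal.ofReal (realBeta a b) := by
    rw [hf, lintegral_rpow_mul_rpow_neg ha hb one_pos, Real.one_rpow, mul_one]
  obtain ⟨M, hM, hev⟩ := exists_eventually_lt_riemannSum (by fun_prop) hfc (hint ▸ hc)
  obtain ⟨n₀, hn₀⟩ := eventually_atTop.1 hev
  set K : ℕ+ → ℕ+ → ℝ := fun i j =>
    (i : ℝ) ^ (b - 1 / p) * (j : ℝ) ^ (a - 1 / q) / ((i : ℝ) + j) ^ (a + b) with hK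
  have hCK (i j : ℕ+) : hilbertMatrix (b - 1 / p) (a - 1 / q) i j = (K i j : ℂ) := by
    rw [hilbertMatrix, hexp]
  have hpos (i : ℕ+) : (0 : ℝ) < i := by exact_mod_cast i.pos
  have hK0 (i j : ℕ+) : 0 ≤ K i j := by
    have := hpos i
    have := hpos j
    positivity
  have hpow (n : ℕ) : ENNReal.ofReal ((n.succPNat : ℝ) ^ (-(1 / p))) ^ p =
      ENNReal.ofReal (1 / ((n : ℝ) + 1)) := by
    have := hpos n.succPNat
    rw [ENNReal.ofReal_rpow_of_nonneg (by positivity) hp.le, ← Real.rpow_mul this.le, neg_mul,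
      one_div_mul_cancel hp.ne', Real.rpow_neg_one, Nat.succPNat_coe, one_div]
    push_cast
    rfl
  let e : ℕ ↪ ℕ+ := ⟨Nat.succPNat, Nat.succPNat_injective⟩
  -- Only rows `i ≤ k` matter: there the truncation at `k * M` keeps all of the `i * M` terms of
  -- the Riemann sum.
  have hrow (k n : ℕ) (hn : n ∈ Finset.Ico n₀ k) :
      ENNReal.ofReal ((n.succPNat : ℝ) ^ (-(1 / p))) * c ≤ ENNReal.ofReal
        (∑ j ∈ (Finset.range (k * M)).map e, K n.succPNat j * (j : ℝ) ^ (-(1 / p))) := by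
    rw [Finset.mem_Ico] at hn
    have hi := hpos n.succPNat
    have hsucc : ((n + 1 : ℕ) : ℝ) = (n.succPNat : ℝ) := by rw [Nat.succPNat_coe]
    have hterm (m : ℕ) : ENNReal.ofReal (K n.succPNat (e m) * ((e m : ℕ+) : ℝ) ^ (-(1 / p))) =
        ENNReal.ofReal ((n.succPNat : ℝ) ^ (-(1 / p))) *
          (ENNReal.ofReal (1 / (n + 1 : ℕ)) * f (((m + 1 : ℕ) : ℝ) / (n + 1 : ℕ))) := by
      rw [hf, ← ENNReal.ofReal_mul (by positivity), ← ENNReal.ofReal_mul (by positivity), hK]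
      simp only
      rw [kernel_mul_rpow_eq hpq hi (hpos _), hsucc]
      rfl
    rw [ENNReal.ofReal_sum_of_nonneg fun j _ =>
      mul_nonneg (hK0 _ _) (Real.rpow_nonneg (hpos j).le _), Finset.sum_map]
    simp only [hterm]
    rw [← Finset.mul_sum]
    refine mul_le_mul_right ((hn₀ (n + 1) (by omega)).le.trans ?_) _
    exact Finset.sum_le_sum_of_subset (Finset.range_subset_range.2
      (Nat.mul_le_mul_right M (by omega)))
  have hmain (k : ℕ) : c ^ p * ENNReal.ofReal (∑ n ∈ Finset.Ico n₀ k, 1 / ((n : ℝ) + 1)) ≤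
      h.opNorm ^ p * ENNReal.ofReal (∑ n ∈ Finset.range (k * M), 1 / ((n : ℝ) + 1)) := by
    have hle := h.sum_rpow_le hpq.lt hCK hK0
      (x := fun j => (j : ℝ) ^ (-(1 / p))) (fun j => Real.rpow_nonneg (hpos j).le _)
      ((Finset.range (k * M)).map e) ((Finset.Ico n₀ k).map e)
    rw [Finset.sum_map, Finset.sum_map] at hle
    rw [ENNReal.ofReal_sum_of_nonneg fun n _ => by positivity,
      ENNReal.ofReal_sum_of_nonneg fun n _ => by positivity, Finset.mul_sum]
    refine (Finset.sum_le_sum fun n hn => ?_).trans (hle.trans_eq ?_)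
    · rw [← hpow, mul_comm, ← ENNReal.mul_rpow_of_nonneg _ _ hp.le]
      exact ENNReal.rpow_le_rpow (hrow k n hn) hp.le
    · exact congrArg _ (Finset.sum_congr rfl fun n _ => hpow n)
  rw [← ENNReal.rpow_le_rpow_iff hp, ← ENNReal.toReal_le_toReal hcp hTp]
  refine le_of_mul_harmonic_le ENNReal.toReal_nonneg hM (n₀ := n₀) fun k => ?_
  have hk := ENNReal.toReal_mono (ENNReal.mul_ne_top hTp ENNReal.ofReal_ne_top) (hmain k)
  rwa [ENNReal.toReal_mul, ENNReal.toReal_mul, ENNReal.toReal_ofReal, ENNReal.toReal_ofReal] at hk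
  · exact Finset.sum_nonneg fun n _ => by positivity
  · exact Finset.sum_nonneg fun n _ => by positivity

theorem theorem1p4 (p q α β : ℝ) (hp : 1 < p) (hpq : 1 / p + 1 / q = 1)
    (hα : -(1 / p) < α) (hα2 : α ≤ 2) (hβ : -(1 / q) < β) (hβ2 : β ≤ 2) :
    ∃ h : ActsOnLp p (hilbertMatrix α β),
      h.opNorm = ENNReal.ofReal (realBeta (α + 1 / p) (β + 1 / q)) := by
  have hc : p.HolderConjugate q := Real.holderConjugate_iff.2 ⟨hp, by simpa using hpq⟩
  have hp1 : 1 / p < 1 := (div_lt_one hc.pos).2 hp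
  have hq1 : 1 / q < 1 := (div_lt_one hc.symm.pos).2 hc.symm.lt
  have ha : 0 < β + 1 / q := by linarith
  have hb : 0 < α + 1 / p := by linarith
  have hle := hilbertMatrix_upper hc ha (by linarith) hb (by linarith)
  have hge := hilbertMatrix_lower hc ha hb
  rw [add_sub_cancel_right, add_sub_cancel_right] at hle hge
  obtain ⟨h, hh⟩ := hle
  rw [realBeta_comm hb ha]
  exact ⟨h, le_antisymm hh (hge h)⟩
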